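/- **Conventions.** For a finite sequence $s$ of natural numbers let $N_s\subseteq\omega^\omega$ be the set of infinite sequences extending $s$. A function $f:\omega^\omega\to\omega^\omega$ is *computable* if there is a computable $\varphi:\omega^{<\omega}\to\omega^{<\omega}$ (finite sequences being coded by natural numbers in the standard way) such that $s\subseteq t$ implies $\varphi(s)\subseteq\varphi(t)$, and for every $x\in\omega^\omega$ the lengths of the sequences $\varphi(x\restriction n)$ tend to infinity and $f(x)=\bigcup_n\varphi(x\restriction n)$. For $A,B\subseteq\omega^\omega$ write $A\le_{\mathrm{Comp}}B$ if $A=f^{-1}(B)$ for some computable $f$. This is a preorder; let $[A]$ be the degree of $A$, i.e. its class under the equivalence relation induced by $\le_{\mathrm{Comp}}$, and for a class $\Gamma$ of subsets of $\omega^\omega$ let $\mathrm{Deg}_\Gamma(\mathrm{Comp})$ be the set of degrees $[A]$, $A\in\Gamma$, partially ordered by $[A]\le[B]\iff A\le_{\mathrm{Comp}}B$. A set is $\Sigma^0_1$ if it is a union $\bigcup_{s\in W}N_s$ with $W$ recursively enumerable, and $\Pi^0_1$ if its complement is $\Sigma^0_1$. A sequence $\langle A_n\mid n\in\omega\rangle$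 of subsets of $\omega^\omega$ is *uniformly $\Pi^0_1$* if there is a recursively enumerable $W\subseteq\omega\times\omega^{<\omega}$ with $\omega^\omega\setminus A_n=\bigcup_{(n,s)\in W}N_s$ for all $n$. A set is $\Sigma^0_2$ if it is the union of a uniformly $\Pi^0_1$ sequence. **Theorem 3.1.** There is a uniformly $\Pi^0_1$ sequence $\langle A_n\mid n\in\omega\rangle$ of nonempty subsets of $\omega^\omega$ such that for no $n$ is there a computable $g:\omega^\omega\to\omega^\omega$ with $g(A_n)\subseteq\bigcup_{m\ne n}A_m$, and such that: 1. the map $X\mapsto[\psi_0(X)]$, where $\psi_0(X)=\bigcup_{n\in X}n^\smallfrown A_n$, is an embedding of the recursive subsets of $\omega$, ordered by inclusion, into $\mathrm{Deg}_{\Pi^0_1}(\mathrm{Comp})$; 2. the map $X\mapsto[\psi_1(X)]$, where $\psi_1(X)=\bigcup_{n\in X}\bigcup_{k,i\in\omega}n^\smallfrown0^{(k)\smallfrown}(i+1)^\smallfrown A_n$ and $0^{(k)}$ is the sequence of $k$ zeros, is an embedding of the recursively enumerable subsets of $\omega$, ordered by inclusion, into $\mathrm{Deg}_{\Sigma^0_2}(\mathrm{Comp})$.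 In particular, the recursive subsets of $\omega$ under inclusion embed into $\mathrm{Deg}_{\Pi^0_1}(\mathrm{Comp})$, and the recursively enumerable ones into $\mathrm{Deg}_{\Sigma^0_2}(\mathrm{Comp})$. (An embedding of partial orders is a map $e$ with $X\le Y\iff e(X)\le e(Y)$.) -/

import Mathlib

namespace BaireComp

/-- The Baire space: all infinite sequences of natural numbers. -/
abbrev Baire : Type := ℕ → ℕ

/-- The initial segment of `x` of length `n`. -/
def restrict (x : Baire) (n : ℕ) : List ℕ := (List.range n).map x

/-- The basic clopen set of all infinite sequences extending `s`. -/
def nbhd (s : List ℕ) : Set Baire := {x | restrict x s.length = s}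

/-- Concatenation of a finite sequence with an infinite one. -/
def concat (s : List ℕ) (x : Baire) : Baire :=
  fun i => if h : i < s.length then s[i] else x (i - s.length)

/-- `φ` is an approximating function for `f`: it is monotone for extension of finite sequences,
the lengths of the values along the initial segments of any `x` tend to infinity, and all these
values are initial segments of `f x` (so that `f x` is their union). -/
structure IsApprox (φ : List ℕ → List ℕ) (f : Baire → Baire) : Prop where
  mono : ∀ s t : List ℕ, s <+: t → φ s <+: φ t
  tendsto_length : ∀ x : Baire,
    Filter.Tendsto (fun n => (φ (restrict x n)).length) Filter.atTop Filter.atTop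
  mem_nbhd : ∀ (x : Baire) (n : ℕ), f x ∈ nbhd (φ (restrict x n))

/-- A function on the Baire space is computable if it has a computable approximating function. -/
def IsComputable (f : Baire → Baire) : Prop :=
  ∃ φ : List ℕ → List ℕ, Computable φ ∧ IsApprox φ f

/-- Reducibility by computable functions: `A` is the preimage of `B` under such a function. -/
def CompReducible (A B : Set Baire) : Prop :=
  ∃ f : Baire → Baire, IsComputable f ∧ A = f ⁻¹' B

theorem length_restrict (x : Baire) (n : ℕ) : (restrict x n).length = n := by
  simp [restrict]

theorem isComputable_id : IsComputable id := by
  refine ⟨id, Computable.id, fun s t h => h, fun x => ?_, fun x n => ?_⟩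
  · simpa [length_restrict, Function.id_def] using (Filter.tendsto_id (x := Filter.atTop (α := ℕ)))
  · simp [nbhd, length_restrict]

theorem IsComputable.comp {g f : Baire → Baire} (hg : IsComputable g) (hf : IsComputable f) :
    IsComputable (g ∘ f) := by
  obtain ⟨ψ, hψ, aψ⟩ := hg
  obtain ⟨φ, hφ, aφ⟩ := hf
  have key : ∀ x n, ψ (φ (restrict x n)) = ψ (restrict (f x) (φ (restrict x n)).length) := by
    intro x n
    have h : restrict (f x) (φ (restrict x n)).length = φ (restrict x n) := aφ.mem_nbhd x n
    rw [h]
  refine ⟨ψ ∘ φ, hψ.comp hφ, fun s t h => aψ.mono _ _ (aφ.mono _ _ h), fun x => ?_,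
    fun x n => ?_⟩
  · simp only [Function.comp_apply, key]
    exact (aψ.tendsto_length (f x)).comp (aφ.tendsto_length x)
  · simp only [Function.comp_apply, key]
    exact aψ.mem_nbhd (f x) _

/-- Subsets of the Baire space, preordered by computable reducibility (not by inclusion). -/
structure RedSet where
  carrier : Set Baire

instance : Preorder RedSet where
  le A B := CompReducible A.carrier B.carrier
  le_refl _ := ⟨id, isComputable_id, rfl⟩
  le_trans := by
    rintro A B C ⟨f, hf, h⟩ ⟨g, hg, h'⟩
    exact ⟨g ∘ f, hg.comp hf, by rw [h, h', Set.preimage_comp]⟩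

/-- The partial order of the degrees of all subsets of the Baire space under computable
reducibility. -/
abbrev CompDeg : Type := Antisymmetrization RedSet (· ≤ ·)

/-- The degree of a set. -/
def deg (A : Set Baire) : CompDeg := toAntisymmetrization (· ≤ ·) (⟨A⟩ : RedSet)

/-- The degrees of the sets in the class `Γ`, with the order inherited from `CompDeg`. -/
abbrev DegIn (Γ : Set (Set Baire)) : Type := {d : CompDeg // d ∈ deg '' Γ}

/-- `A` is `Σ⁰₁`: a union of a recursively enumerable family of basic clopen sets. -/
def IsSigma01 (A : Set Baire) : Prop :=
  ∃ W : Set (List ℕ), REPred (fun s => s ∈ W) ∧ A = ⋃ s ∈ W, nbhd s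

/-- `A` is `Π⁰₁`: its complement is `Σ⁰₁`. -/
def IsPi01 (A : Set Baire) : Prop := IsSigma01 Aᶜ

/-- The sequence `A` is uniformly `Σ⁰₁`, that is `{(n, x) | x ∈ A n}` is a `Σ⁰₁` subset of the
product of `ℕ` with the Baire space. -/
def IsSigma01Seq (A : ℕ → Set Baire) : Prop :=
  ∃ W : Set (ℕ × List ℕ), REPred (fun p => p ∈ W) ∧
    ∀ n, A n = ⋃ s ∈ {s : List ℕ | (n, s) ∈ W}, nbhd s

/-- The sequence `A` is uniformly `Π⁰₁`. -/
def IsPi01Seq (A : ℕ → Set Baire) : Prop := IsSigma01Seq fun n => (A n)ᶜ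

/-- `A` is `Σ⁰₂`: the projection along `ℕ` of a `Π⁰₁` subset of the product of `ℕ` with the
Baire space. -/
def IsSigma02 (A : Set Baire) : Prop :=
  ∃ P : ℕ → Set Baire, IsPi01Seq P ∧ A = ⋃ n, P n

/-- The recursive subsets of `ℕ`; as a subtype of `Set ℕ` it is ordered by inclusion. -/
abbrev RecursiveSet : Type := {X : Set ℕ // ComputablePred (fun n => n ∈ X)}

/-- The recursively enumerable subsets of `ℕ`, ordered by inclusion. -/
abbrev RESet : Type := {X : Set ℕ // REPred (fun n => n ∈ X)}

/-- The union over `n ∈ X` of the sets `n ⌢ A n`. -/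
def psi0 (A : ℕ → Set Baire) (X : Set ℕ) : Set Baire :=
  ⋃ n ∈ X, concat [n] '' A n

/-- The union over `n ∈ X` and all `k`, `i` of the sets `n ⌢ 0 ⌢ ⋯ ⌢ 0 ⌢ (i + 1) ⌢ A n`, with
`k` zeros. -/
def psi1 (A : ℕ → Set Baire) (X : Set ℕ) : Set Baire :=
  ⋃ n ∈ X, ⋃ k : ℕ, ⋃ i : ℕ, concat (n :: (List.replicate k 0 ++ [i + 1])) '' A n

end BaireComp

/-!
The sets `A n` are singletons `{solution n}`, where the sequences `solution n` are pairwise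
incomparable: no computable function maps `solution n` to `solution m` for `n ≠ m`. They come from
a Friedberg–Muchnik construction of uniformly recursively enumerable sets `C n`. Instead of the
characteristic function of `C n`, `solution n` lists for every `k` one plus the stage at which `k`
is enumerated in `C n`, or `0` if it never is. A positive value of it can be checked at one stage,
and a wrong value `0` is eventually detected, so the singletons are uniformly `Π⁰₁`
(`isPi01Seq_singleton_solution`).

The requirement `⟨e, ⟨n, m⟩⟩` asks that the functional with code `e` does not map `solution n` to
`solution m`. When the functional, applied to an initial segment of the current approximation to
`solution n`, gives the value `0` at the current witness, the witness is enumerated in `C m`. An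
action injures all requirements of lower priority, that is of larger number; they continue with new
witnesses larger than the stage of the injury, so that they never change the initial segment used.
Each requirement acts only finitely often (`eventually_le_of_act`), and either its last action
persists or its final witness is never enumerated; in both cases it is met if `n ≠ m` and `e` is
the code of a computable function (`apply_solution_ne`). The other requirements do no harm, as they
too act only finitely often.

Given incomparable `a n`, a reduction of `psi0 X` or `psi1 X` to the same union over `Y` maps, for
`n ∈ X`, some sequence consisting of a finite prefix and `a n` to a finite prefix followed by `a m`
with `m ∈ Y`. Removing the prefixes is computable, because they are fixed finite sequences, so
`n = m ∈ Y`. Conversely let `X ⊆ Y`. For recursive `X` the reduction of `psi0 X` to `psi0 Y` is the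
identity on the sequences with first term in `X` and zero elsewhere; `0` is outside `psi0 Y` since
no `a n` is computable. For recursively enumerable `X` membership of the first term cannot be
decided in time, but zeros may be output while waiting (`exists_isComputable_delay`): leading zeros
do not matter for `psi1`, and a sequence ending in zeros only is outside it.
-/

namespace BaireComp

open Nat.Partrec (Code)

/-! ### Recursively enumerable predicates -/

theorem REPred.exists_nat {α : Type*} [Primcodable α] {d : α → ℕ → Bool} (hd : Computable₂ d) :
    REPred fun a => ∃ u, d a u = true := by
  have h : Partrec fun a => Nat.rfind fun u => Part.some (d a u) := Partrec.rfind hd.partrec₂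
  refine h.dom_re.of_eq fun a => ?_
  refine Nat.rfind_dom.trans ?_
  constructor
  · rintro ⟨u, hu, -⟩
    exact ⟨u, (Part.mem_some_iff.1 hu).symm⟩
  · rintro ⟨u, hu⟩
    exact ⟨u, Part.mem_some_iff.2 hu.symm, fun _ => trivial⟩

/-- A recursively enumerable predicate is the union of an increasing sequence of uniformly
primitive recursive ones. -/
theorem REPred.exists_stages {α : Type*} [Primcodable α] {p : α → Prop} (hp : REPred p) :
    ∃ d : α → ℕ → Bool, Primrec₂ d ∧ (∀ a, p a ↔ ∃ u, d a u = true) ∧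
      ∀ a u v, u ≤ v → d a u = true → d a v = true := by
  obtain ⟨c, hc⟩ := Code.exists_code.1 hp
  refine ⟨fun a u => (Code.evaln u c (Encodable.encode a)).isSome, ?_, fun a => ?_, ?_⟩
  · exact Primrec.option_isSome.comp (Code.primrec_evaln.comp
      ((Primrec.snd.pair (Primrec.const c)).pair (Primrec.encode.comp Primrec.fst)))
  · have h : p a ↔ (c.eval (Encodable.encode a)).Dom := by
      rw [hc]
      simp [Encodable.encodek, Part.assert]
    rw [h, Part.dom_iff_mem]
    simp only [Code.evaln_complete, Option.isSome_iff_exists]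
    exact exists_comm
  · intro a u v huv h
    obtain ⟨y, hy⟩ := Option.isSome_iff_exists.1 h
    exact Option.isSome_iff_exists.2 ⟨y, Code.evaln_mono huv hy⟩

/-! ### Initial segments -/

theorem mem_nbhd_iff_eq_restrict {x : Baire} {s : List ℕ} :
    x ∈ nbhd s ↔ s = restrict x s.length := eq_comm

theorem restrict_getElem? (x : Baire) {l i : ℕ} (h : i < l) : (restrict x l)[i]? = some (x i) := by
  simp [restrict, h]

theorem restrict_congr {x y : Baire} {l : ℕ} (h : ∀ i < l, x i = y i) :
    restrict x l = restrict y l :=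
  List.map_congr_left fun i hi => h i (List.mem_range.1 hi)

theorem restrict_eq_iff {x y : Baire} {l : ℕ} :
    restrict x l = restrict y l ↔ ∀ i < l, x i = y i := by
  simp [restrict]

/-- A sequence of sets is uniformly `Π⁰₁` if leaving the `n`-th set is recognized, recursively
enumerably in `n`, at some initial segment. -/
theorem isPi01Seq_iff {A : ℕ → Set Baire} :
    IsPi01Seq A ↔ ∃ W : ℕ × List ℕ → Prop, REPred W ∧
      ∀ n x, x ∉ A n ↔ ∃ l, W (n, restrict x l) := by
  have key : ∀ (W : ℕ × List ℕ → Prop) n x,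
      (x ∈ ⋃ s ∈ {s : List ℕ | W (n, s)}, nbhd s) ↔ ∃ l, W (n, restrict x l) := by
    intro W n x
    simp only [Set.mem_iUnion, Set.mem_ofPred_eq, exists_prop]
    constructor
    · rintro ⟨s, hs, hx⟩
      exact ⟨s.length, by rwa [← mem_nbhd_iff_eq_restrict.1 hx]⟩
    · rintro ⟨l, hl⟩
      exact ⟨_, hl, by simp [nbhd, length_restrict]⟩
  constructor
  · rintro ⟨W, hW, h⟩
    refine ⟨fun p => p ∈ W, hW, fun n x => ?_⟩
    rw [← key, ← Set.mem_compl_iff]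
    exact Set.ext_iff.1 (h n) x
  · rintro ⟨W, hW, h⟩
    refine ⟨{p | W p}, hW, fun n => Set.ext fun x => ?_⟩
    rw [Set.mem_compl_iff, h]
    exact (key W n x).symm

/-! ### The finite injury construction -/

/-- The source `n` of the requirement with number `r = ⟨e, ⟨n, m⟩⟩`, which asks that the
functional with code `e` does not map `solution n` to `solution m`. -/
def source (r : ℕ) : ℕ := r.unpair.2.unpair.1

/-- The target `m` of the requirement with number `r = ⟨e, ⟨n, m⟩⟩`. -/
def target (r : ℕ) : ℕ := r.unpair.2.unpair.2

/-- The approximation to the `n`-th sequence given by a history, a list of pairs `(k, t)` saying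
that the witness `k` was enumerated at stage `t`. The witness `k` is kept in the sequence of the
target of the requirement `k.unpair.1`, and its value there is `t + 1`; the value is `0` as long
as nothing is enumerated. -/
def approx (H : List (ℕ × ℕ)) (n k : ℕ) : ℕ :=
  if target k.unpair.1 = n then ((H.lookup k).map Nat.succ).getD 0 else 0

/-- The most recent action in a history (with the newest entry first) by a requirement of priority
at least that of `r`. -/
def lastAction (H : List (ℕ × ℕ)) (r : ℕ) : Option (ℕ × ℕ) :=
  (H.filter fun a => a.1.unpair.1 ≤ r).head?

/-- The requirement `r` has acted and has not been injured since by one of higher priority. -/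
def Satisfied (H : List (ℕ × ℕ)) (r : ℕ) : Prop :=
  (lastAction H r).map (fun a => a.1.unpair.1) = some r

instance (H : List (ℕ × ℕ)) (r : ℕ) : Decidable (Satisfied H r) :=
  inferInstanceAs (Decidable (_ = _))

/-- The current witness of the requirement `r`. Its second component exceeds the stage of the last
injury, hence exceeds all initial segments which requirements of higher priority want to
preserve. -/
def witness (H : List (ℕ × ℕ)) (r : ℕ) : ℕ :=
  Nat.pair r (((lastAction H r).map fun a => a.2 + 1).getD 0)

/-- Within `t` steps the functional of the requirement `r`, applied to the initial segment of
length `l` of the current approximation to its source, gives the value `0` at the current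
witness. -/
def Ready (H : List (ℕ × ℕ)) (t r l : ℕ) : Prop :=
  ((Code.evaln t (Denumerable.ofNat Code r.unpair.1)
    (Encodable.encode (restrict (approx H (source r)) l))).bind
      (Encodable.decode (α := List ℕ))).bind (fun w => w[witness H r]?) = some 0

instance (H : List (ℕ × ℕ)) (t r l : ℕ) : Decidable (Ready H t r l) :=
  inferInstanceAs (Decidable (_ = _))

/-- The witness enumerated at stage `t = ⟨r, ⟨l, i⟩⟩`, if any. Only the requirement `r` may act at
that stage, looking only at initial segments of length `l`. -/
def action (H : List (ℕ × ℕ)) (t : ℕ) : Option ℕ :=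
  if ¬ Satisfied H t.unpair.1 ∧ Ready H t t.unpair.1 t.unpair.2.unpair.1 then
    some (witness H t.unpair.1)
  else none

/-- The history of the construction before stage `t`, with the newest entry first. -/
def history : ℕ → List (ℕ × ℕ)
  | 0 => []
  | t + 1 => ((action (history t) t).map fun k => (k, t)).toList ++ history t

/-- The witness enumerated at stage `t` of the construction, if any. -/
def act (t : ℕ) : Option ℕ := action (history t) t

theorem primrec_source : Primrec source :=
  Primrec.fst.comp (Primrec.unpair.comp (Primrec.snd.comp Primrec.unpair))

theorem primrec_target : Primrec target :=
  Primrec.snd.comp (Primrec.unpair.comp (Primrec.snd.comp Primrec.unpair))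

theorem primrec_approx : Primrec fun p : List (ℕ × ℕ) × ℕ × ℕ => approx p.1 p.2.1 p.2.2 := by
  refine Primrec.ite (Primrec.eq.comp ?_ (Primrec.fst.comp Primrec.snd)) ?_ (Primrec.const 0)
  · exact primrec_target.comp (Primrec.fst.comp (Primrec.unpair.comp
      (Primrec.snd.comp Primrec.snd)))
  · exact Primrec.option_getD.comp (Primrec.option_map
      (Primrec.listLookup.comp (Primrec.snd.comp Primrec.snd) Primrec.fst)
      (Primrec.succ.comp Primrec.snd).to₂) (Primrec.const 0)

theorem primrec_restrict_approx {α : Type*} [Primcodable α] {H : α → List (ℕ × ℕ)} {n l : α → ℕ}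
    (hH : Primrec H) (hn : Primrec n) (hl : Primrec l) :
    Primrec fun a => restrict (approx (H a) (n a)) (l a) := by
  have hg : Primrec fun p : α × ℕ => (H p.1, n p.1, p.2) :=
    Primrec.pair (hH.comp Primrec.fst) (Primrec.pair (hn.comp Primrec.fst) Primrec.snd)
  have h' := primrec_approx.comp hg
  have h : Primrec₂ fun (a : α) (k : ℕ) => approx (H a) (n a) k := h'
  exact Primrec.list_map (Primrec.list_range.comp hl) h

theorem primrec_lastAction : Primrec₂ lastAction := by
  have h : PrimrecRel fun (a : ℕ × ℕ) (r : ℕ) => a.1.unpair.1 ≤ r :=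
    Primrec.nat_le.comp (Primrec.fst.comp (Primrec.unpair.comp (Primrec.fst.comp Primrec.fst)))
      Primrec.snd
  exact Primrec.list_head?.comp h.listFilter

theorem primrec_witness : Primrec₂ witness :=
  Primrec₂.natPair.comp Primrec.snd (Primrec.option_getD.comp (Primrec.option_map
    primrec_lastAction (Primrec.succ.comp (Primrec.snd.comp Primrec.snd)).to₂) (Primrec.const 0))

theorem primrecRel_satisfied : PrimrecRel Satisfied :=
  Primrec.eq.comp (Primrec.option_map primrec_lastAction
    (Primrec.fst.comp (Primrec.unpair.comp (Primrec.fst.comp Primrec.snd))).to₂)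
    (Primrec.option_some.comp Primrec.snd)

theorem primrecPred_ready :
    PrimrecPred fun p : List (ℕ × ℕ) × ℕ × ℕ × ℕ => Ready p.1 p.2.1 p.2.2.1 p.2.2.2 := by
  have hr : Primrec fun p : List (ℕ × ℕ) × ℕ × ℕ × ℕ => p.2.2.1 :=
    Primrec.fst.comp (Primrec.snd.comp Primrec.snd)
  have hc : Primrec fun p : List (ℕ × ℕ) × ℕ × ℕ × ℕ => Denumerable.ofNat Code p.2.2.1.unpair.1 :=
    (Primrec.ofNat Code).comp (Primrec.fst.comp (Primrec.unpair.comp hr))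
  have hs : Primrec fun p : List (ℕ × ℕ) × ℕ × ℕ × ℕ =>
      Encodable.encode (restrict (approx p.1 (source p.2.2.1)) p.2.2.2) :=
    Primrec.encode.comp (primrec_restrict_approx Primrec.fst (primrec_source.comp hr)
      (Primrec.snd.comp (Primrec.snd.comp Primrec.snd)))
  have he : Primrec fun p : List (ℕ × ℕ) × ℕ × ℕ × ℕ =>
      Code.evaln p.2.1 (Denumerable.ofNat Code p.2.2.1.unpair.1)
        (Encodable.encode (restrict (approx p.1 (source p.2.2.1)) p.2.2.2)) :=
    Code.primrec_evaln.comp (Primrec.pair (Primrec.pair (Primrec.fst.comp Primrec.snd) hc) hs)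
  have hw : Primrec₂ fun (p : List (ℕ × ℕ) × ℕ × ℕ × ℕ) (w : List ℕ) =>
      w[witness p.1 p.2.2.1]? :=
    Primrec.list_getElem?.comp Primrec.snd
      (primrec_witness.comp (Primrec.fst.comp Primrec.fst) (hr.comp Primrec.fst))
  have hd : Primrec fun p : List (ℕ × ℕ) × ℕ × ℕ × ℕ =>
      (Code.evaln p.2.1 (Denumerable.ofNat Code p.2.2.1.unpair.1)
        (Encodable.encode (restrict (approx p.1 (source p.2.2.1)) p.2.2.2))).bind
          (Encodable.decode (α := List ℕ)) :=
    Primrec.option_bind he (Primrec.decode.comp Primrec.snd).to₂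
  have hb := Primrec.option_bind hd hw
  exact PrimrecRel.comp Primrec.eq hb (Primrec.const (some 0))

theorem primrec_action : Primrec₂ action := by
  have hr : Primrec fun p : List (ℕ × ℕ) × ℕ => p.2.unpair.1 :=
    Primrec.fst.comp (Primrec.unpair.comp Primrec.snd)
  refine Primrec.ite (PrimrecPred.and (PrimrecPred.not
    (primrecRel_satisfied.comp Primrec.fst hr)) ?_)
    (Primrec.option_some.comp (primrec_witness.comp Primrec.fst hr)) (Primrec.const none)
  exact primrecPred_ready.comp (Primrec.pair Primrec.fst (Primrec.pair Primrec.snd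
    (Primrec.pair hr (Primrec.fst.comp (Primrec.unpair.comp
      (Primrec.snd.comp (Primrec.unpair.comp Primrec.snd)))))))

theorem primrec_history : Primrec history := by
  have h : Primrec₂ fun (t : ℕ) (H : List (ℕ × ℕ)) =>
      ((action H t).map fun k => (k, t)).toList ++ H :=
    Primrec.list_append.comp (Primrec.optionToList.comp (Primrec.option_map
      (primrec_action.comp Primrec.snd Primrec.fst)
      (Primrec.pair Primrec.snd (Primrec.fst.comp Primrec.fst)).to₂)) Primrec.snd
  refine (Primrec.nat_rec₁ [] h).of_eq fun t => ?_
  induction t with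
  | zero => rfl
  | succ t ih => simp only [history, ← ih]

/-! ### Verification of the construction -/

theorem lastAction_succ_of_le {t k r : ℕ} (h : act t = some k) (hk : k.unpair.1 ≤ r) :
    lastAction (history (t + 1)) r = some (k, t) := by
  have h' : action (history t) t = some k := h
  simp [lastAction, history, h', hk]

theorem lastAction_succ {t r : ℕ} (h : ∀ k, act t = some k → r < k.unpair.1) :
    lastAction (history (t + 1)) r = lastAction (history t) r := by
  cases h' : action (history t) t with
  | none => simp [lastAction, history, h']
  | some k =>
    have := h k h'
    simp [lastAction, history, h', this]

theorem lastAction_spec {t r k u : ℕ} (h : lastAction (history t) r = some (k, u)) :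
    u < t ∧ k.unpair.1 ≤ r ∧ act u = some k ∧
      ∀ v, u < v → v < t → ∀ k', act v = some k' → r < k'.unpair.1 := by
  induction t with
  | zero => simp [lastAction, history] at h
  | succ t ih =>
    by_cases hc : ∀ k, act t = some k → r < k.unpair.1
    · rw [lastAction_succ hc] at h
      obtain ⟨h1, h2, h3, h4⟩ := ih h
      refine ⟨by omega, h2, h3, fun v hv hv' => ?_⟩
      rcases Nat.lt_succ_iff_lt_or_eq.1 hv' with hlt | rfl
      · exact h4 v hv hlt
      · exact hc
    · push Not at hc
      obtain ⟨k', hk', hle⟩ := hc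
      rw [lastAction_succ_of_le hk' hle] at h
      obtain ⟨rfl, rfl⟩ := Prod.mk.inj (Option.some.inj h)
      exact ⟨Nat.lt_succ_self _, hle, hk', fun v hv hv' => by omega⟩

theorem exists_lastAction {t r k u : ℕ} (h : act u = some k) (hk : k.unpair.1 ≤ r) (hu : u < t) :
    ∃ k' u', lastAction (history t) r = some (k', u') ∧ u ≤ u' := by
  induction t with
  | zero => omega
  | succ t ih =>
    by_cases hc : ∀ k, act t = some k → r < k.unpair.1
    · rw [lastAction_succ hc]
      refine ih (lt_of_le_of_ne (Nat.lt_succ_iff.1 hu) ?_)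
      rintro rfl
      exact absurd (hc k h) (by omega)
    · push Not at hc
      obtain ⟨k', hk', hle⟩ := hc
      exact ⟨k', t, lastAction_succ_of_le hk' hle, Nat.lt_succ_iff.1 hu⟩

theorem act_eq_some {t k : ℕ} (h : act t = some k) :
    k = witness (history t) t.unpair.1 ∧ ¬ Satisfied (history t) t.unpair.1 ∧
      Ready (history t) t t.unpair.1 t.unpair.2.unpair.1 := by
  unfold act action at h
  split_ifs at h with hc
  exact ⟨(Option.some.inj h).symm, hc⟩

theorem act_unpair_fst {t k : ℕ} (h : act t = some k) : k.unpair.1 = t.unpair.1 := by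
  rw [(act_eq_some h).1, witness, Nat.unpair_pair]

theorem act_unpair_snd_le {t k : ℕ} (h : act t = some k) : k.unpair.2 ≤ t := by
  rw [(act_eq_some h).1, witness, Nat.unpair_pair]
  cases hl : lastAction (history t) t.unpair.1 with
  | none => simp
  | some a => simpa using (lastAction_spec (k := a.1) (u := a.2) hl).1

/-- Witnesses are chosen above the stages of all earlier actions of at least the same priority. -/
theorem lt_unpair_snd_of_act {u t k k' : ℕ} (hu : act u = some k') (ht : act t = some k)
    (hut : u < t) (hk : k'.unpair.1 ≤ k.unpair.1) : u < k.unpair.2 := by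
  rw [act_unpair_fst ht] at hk
  obtain ⟨k₁, u₁, h₁, hle⟩ := exists_lastAction hu hk hut
  rw [(act_eq_some ht).1, witness, Nat.unpair_pair, h₁]
  simpa using Nat.lt_succ_of_le hle

theorem act_injective {u t k : ℕ} (hu : act u = some k) (ht : act t = some k) : u = t := by
  rcases lt_trichotomy u t with h | h | h
  · have := lt_unpair_snd_of_act hu ht h le_rfl
    have := act_unpair_snd_le hu
    omega
  · exact h
  · have := lt_unpair_snd_of_act ht hu h le_rfl
    have := act_unpair_snd_le ht
    omega

/-- Every requirement is injured, and acts, only finitely often: a requirement acts at most once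
after its last injury. -/
theorem eventually_le_of_act (r : ℕ) :
    ∃ t₀, ∀ t, t₀ ≤ t → ∀ k, act t = some k → r ≤ k.unpair.1 := by
  induction r with
  | zero => exact ⟨0, fun _ _ _ _ => Nat.zero_le _⟩
  | succ r ih =>
    obtain ⟨t₀, h₀⟩ := ih
    by_cases hc : ∃ t, t₀ ≤ t ∧ ∃ k, act t = some k ∧ k.unpair.1 = r
    · obtain ⟨t₁, h₁, k₁, hk₁, hr⟩ := hc
      refine ⟨t₁ + 1, fun t ht k hk => ?_⟩
      refine Nat.succ_le_of_lt (lt_of_le_of_ne (h₀ t (by omega) k hk) fun hkr => ?_)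
      obtain ⟨k', u', hl, hu'⟩ := exists_lastAction hk₁ hr.le (show t₁ < t by omega)
      obtain ⟨-, h2, h3, -⟩ := lastAction_spec hl
      have h4 := h₀ u' (by omega) k' h3
      refine (act_eq_some hk).2.1 ?_
      rw [← act_unpair_fst hk, ← hkr, Satisfied, hl]
      simp only [Option.map_some, Option.some.injEq]
      omega
    · push Not at hc
      exact ⟨t₀, fun t ht k hk => Nat.succ_le_of_lt
        (lt_of_le_of_ne (h₀ t ht k hk) (hc t ht k hk).symm)⟩

open Classical in
/-- One plus the stage at which `k` is enumerated, and `0` if it never is. -/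
noncomputable def entryTime (k : ℕ) : ℕ :=
  if h : ∃ t, act t = some k then h.choose + 1 else 0

theorem entryTime_of_act {t k : ℕ} (h : act t = some k) : entryTime k = t + 1 := by
  have h' : ∃ t, act t = some k := ⟨t, h⟩
  rw [entryTime, dif_pos h', act_injective h'.choose_spec h]

theorem act_of_entryTime {t k : ℕ} (h : entryTime k = t + 1) : act t = some k := by
  unfold entryTime at h
  split_ifs at h with h'
  rw [← Nat.succ.inj h]
  exact h'.choose_spec

theorem getD_lookup_history (t k : ℕ) :
    (((history t).lookup k).map Nat.succ).getD 0 = if entryTime k ≤ t then entryTime k else 0 := by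
  induction t with
  | zero => simpa [history] using Eq.symm
  | succ t ih =>
    cases h : act t with
    | none =>
      have h' : action (history t) t = none := h
      have hne : entryTime k ≠ t + 1 := fun he => by simp [act_of_entryTime he] at h
      simp only [history, h', Option.map_none, Option.toList_none, List.nil_append, ih]
      exact if_congr (by omega) rfl rfl
    | some k' =>
      have h' : action (history t) t = some k' := h
      by_cases hk : k = k'
      · subst hk
        simp [history, h', entryTime_of_act h]
      · have hne : entryTime k ≠ t + 1 := fun he => hk <| by
          simpa [act_of_entryTime he] using h
        have hb : (k == k') = false := by simpa using hk
        simp only [history, h', Option.map_some, Option.toList_some, List.cons_append,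
          List.nil_append, List.lookup_cons, hb, ih]
        exact if_congr (by omega) rfl rfl

/-- The `n`-th of the sequences constructed: it lists the stages at which the witnesses aimed at
`n` are enumerated. -/
noncomputable def solution (n : ℕ) : Baire := fun k =>
  if target k.unpair.1 = n then entryTime k else 0

theorem approx_history (t n k : ℕ) :
    approx (history t) n k = if solution n k ≤ t then solution n k else 0 := by
  unfold approx solution
  split_ifs <;> simp_all [getD_lookup_history]

/-- A value of `solution n` is verified by looking at a single stage, so that the singletons
`{solution n}` are uniformly `Π⁰₁`. -/
theorem isPi01Seq_singleton_solution : IsPi01Seq fun n => {solution n} := by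
  let d : ℕ × List ℕ → ℕ → Bool := fun p u =>
    decide (restrict (approx (history (p.2.sum + u)) p.1) p.2.length ≠ p.2)
  have hsum : Primrec (List.sum : List ℕ → ℕ) :=
    Primrec.list_foldr Primrec.id (Primrec.const 0)
      (Primrec.nat_add.comp (Primrec.fst.comp Primrec.snd) (Primrec.snd.comp Primrec.snd)).to₂
  have hd : Primrec₂ d := by
    have hs : Primrec fun q : (ℕ × List ℕ) × ℕ => q.1.2 := Primrec.snd.comp Primrec.fst
    have hH : Primrec fun q : (ℕ × List ℕ) × ℕ => history (q.1.2.sum + q.2) :=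
      primrec_history.comp (Primrec.nat_add.comp (hsum.comp hs) Primrec.snd)
    have hr : Primrec fun q : (ℕ × List ℕ) × ℕ =>
        restrict (approx (history (q.1.2.sum + q.2)) q.1.1) q.1.2.length :=
      primrec_restrict_approx hH (Primrec.fst.comp Primrec.fst) (Primrec.list_length.comp hs)
    exact PrimrecPred.decide (PrimrecPred.not (Primrec.eq.comp hr hs))
  refine isPi01Seq_iff.2 ⟨_, REPred.exists_nat hd.to_comp, fun n x => ?_⟩
  simp only [d, decide_eq_true_eq, length_restrict, Set.mem_singleton_iff, ne_eq, restrict_eq_iff]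
  constructor
  · intro hx
    obtain ⟨i, hi⟩ := Function.ne_iff.1 hx
    refine ⟨i + 1, solution n i, fun h => hi ?_⟩
    rw [← h i (Nat.lt_succ_self i), approx_history, if_pos (Nat.le_add_left _ _)]
  · rintro ⟨l, u, h⟩ rfl
    refine h fun i hi => ?_
    rw [approx_history, if_pos]
    refine le_add_right (List.le_sum_of_mem ?_)
    exact List.mem_map.2 ⟨i, List.mem_range.2 hi, rfl⟩

theorem apply_eq_of_approx {φ : List ℕ → List ℕ} {g : Baire → Baire} (hφ : IsApprox φ g)
    {x : Baire} {l k v : ℕ} (h : (φ (restrict x l))[k]? = some v) : g x k = v := by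
  have hk : k < (φ (restrict x l)).length := (List.getElem?_eq_some_iff.1 h).1
  have h1 : restrict (g x) (φ (restrict x l)).length = φ (restrict x l) := hφ.mem_nbhd x l
  rw [← h1, restrict_getElem? _ hk] at h
  exact Option.some.inj h

/-- An initial segment used by an action is preserved if only requirements of lower priority act
later. -/
theorem restrict_approx_eq_solution {u k r l n : ℕ} (hu : act u = some k) (hr : k.unpair.1 = r)
    (hl : l ≤ u) (hn : target r ≠ n)
    (hlow : ∀ v, u < v → ∀ k', act v = some k' → r < k'.unpair.1) :
    restrict (approx (history u) n) l = restrict (solution n) l := by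
  refine restrict_congr fun i hi => ?_
  rw [approx_history]
  refine if_pos (not_lt.1 fun hlt => ?_)
  unfold solution at hlt
  split_ifs at hlt with hti
  swap
  · omega
  obtain ⟨v, hv⟩ : ∃ v, entryTime i = v + 1 := ⟨entryTime i - 1, by omega⟩
  have hact := act_of_entryTime hv
  rcases (show u ≤ v by omega).eq_or_lt with rfl | huv
  · obtain rfl : k = i := Option.some.inj (hu.symm.trans hact)
    exact hn (hr ▸ hti)
  · have h1 := lt_unpair_snd_of_act hu hact huv (hr ▸ (hlow v huv i hact).le)
    have h2 := Nat.unpair_right_le i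
    omega

/-- The sequences constructed are pairwise incomparable. -/
theorem apply_solution_ne {n m : ℕ} (hnm : n ≠ m) {g : Baire → Baire} (hg : IsComputable g) :
    g (solution n) ≠ solution m := by
  intro hgm
  obtain ⟨φ, hφ, hφg⟩ := hg
  obtain ⟨c, hc⟩ := Code.exists_code.1 hφ
  have heval : ∀ s, c.eval (Encodable.encode s) = Part.some (Encodable.encode (φ s)) := by
    intro s
    rw [hc]
    simp
  obtain ⟨r, hrc, hrn, hrm⟩ : ∃ r : ℕ, Denumerable.ofNat Code r.unpair.1 = c ∧
      source r = n ∧ target r = m :=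
    ⟨Nat.pair (Encodable.encode c) (Nat.pair n m), by simp, by simp [source], by simp [target]⟩
  obtain ⟨t₁, ht₁⟩ := eventually_le_of_act (r + 1)
  by_cases hsat : Satisfied (history t₁) r
  ·
    -- The requirement has acted for good: `g (solution n)` vanishes at the witness, where
    -- `solution m` does not.
    obtain ⟨⟨k, u⟩, hlast, hkr⟩ := Option.map_eq_some_iff.1 hsat
    obtain ⟨hut, -, hact, hlow⟩ := lastAction_spec hlast
    have hlow' : ∀ v, u < v → ∀ k', act v = some k' → r < k'.unpair.1 := fun v hv k' hk' => by
      by_cases hvt : v < t₁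
      · exact hlow v hv hvt k' hk'
      · exact ht₁ v (by omega) k' hk'
    obtain ⟨hk, -, hready⟩ := act_eq_some hact
    have hur : u.unpair.1 = r := (act_unpair_fst hact).symm.trans hkr
    rw [hur] at hk hready
    have hl : u.unpair.2.unpair.1 ≤ u :=
      (Nat.unpair_left_le _).trans (Nat.unpair_right_le _)
    rw [Ready, ← hk, hrc, hrn,
      restrict_approx_eq_solution hact hkr hl (hrm.trans_ne hnm.symm) hlow'] at hready
    obtain ⟨w, hw, hwk⟩ := Option.bind_eq_some_iff.1 hready
    obtain ⟨y, hy, hyw⟩ := Option.bind_eq_some_iff.1 hw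
    have hy' := Code.evaln_sound hy
    rw [heval, Part.mem_some_iff] at hy'
    rw [hy', Encodable.encodek, Option.some.injEq] at hyw
    subst hyw
    have h0 := apply_eq_of_approx hφg hwk
    have hkm : target k.unpair.1 = m := by rw [hkr, hrm]
    rw [hgm, solution, if_pos hkm, entryTime_of_act hact] at h0
    omega
  ·
    -- The requirement waits forever with a fixed witness, which is never enumerated.
    have hconst : ∀ t, t₁ ≤ t → lastAction (history t) r = lastAction (history t₁) r := by
      intro t ht
      induction t, ht using Nat.le_induction with
      | base => rfl
      | succ t ht ih => rw [lastAction_succ fun k hk => ht₁ t ht k hk, ih]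
    obtain ⟨k, hk⟩ : ∃ k, k = witness (history t₁) r := ⟨_, rfl⟩
    have hkr : k.unpair.1 = r := by rw [hk, witness, Nat.unpair_pair]
    have hnever : ∀ t, act t ≠ some k := by
      intro t ht
      by_cases htt : t₁ ≤ t
      · have := ht₁ t htt k ht
        omega
      · obtain ⟨k', u', hlast, hle⟩ := exists_lastAction ht hkr.le (not_le.1 htt)
        obtain ⟨-, hk'r, hu', -⟩ := lastAction_spec hlast
        have hk2 : k.unpair.2 = u' + 1 := by rw [hk, witness, hlast]; simp
        have := act_unpair_snd_le ht
        omega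
    have hzero : entryTime k = 0 := by
      by_contra h
      obtain ⟨t, ht⟩ := Nat.exists_eq_succ_of_ne_zero h
      exact hnever t (act_of_entryTime ht)
    have hgk : g (solution n) k = 0 := by
      rw [hgm, solution]
      simp [hzero]
    obtain ⟨l, hl⟩ := ((hφg.tendsto_length (solution n)).eventually_gt_atTop k).exists
    obtain ⟨b, hb⟩ := Code.evaln_complete.1
      ((heval (restrict (solution n) l)).symm ▸ Part.mem_some _)
    -- A late stage reserved for `r` and `l`, at which `solution n` is settled below `l` and the
    -- computation has converged.
    let i := t₁ + b + (restrict (solution n) l).sum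
    let t := Nat.pair r (Nat.pair l i)
    have hit : i ≤ t := (Nat.right_le_pair _ _).trans (Nat.right_le_pair _ _)
    have hsettled : restrict (approx (history t) n) l = restrict (solution n) l := by
      refine restrict_congr fun j hj => ?_
      rw [approx_history, if_pos]
      have : solution n j ≤ (restrict (solution n) l).sum :=
        List.le_sum_of_mem (List.mem_map.2 ⟨j, List.mem_range.2 hj, rfl⟩)
      omega
    have hlast := hconst t (by omega)
    have hwit : witness (history t) r = k := by rw [hk, witness, witness, hlast]
    have hready : Ready (history t) t r l := by
      rw [Ready, hwit, hrc, hrn, hsettled,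
        Option.mem_def.1 (Code.evaln_mono (show b ≤ t by omega) hb), Option.bind_some,
        Encodable.encodek, Option.bind_some, List.getElem?_eq_getElem hl, Option.some.injEq]
      rw [← hgk]
      exact (apply_eq_of_approx hφg (List.getElem?_eq_getElem hl)).symm
    have hunsat : ¬ Satisfied (history t) r := by rwa [Satisfied, hlast]
    refine hnever t ?_
    have h1 : t.unpair.1 = r := by simp [t]
    have h2 : t.unpair.2.unpair.1 = l := by simp [t]
    rw [act, action, h1, h2, if_pos ⟨hunsat, hready⟩, hwit]

/-! ### Shifting and concatenation -/

/-- The sequence `x` without its first `l` terms. -/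
def shift (l : ℕ) (x : Baire) : Baire := fun i => x (i + l)

theorem restrict_add (x : Baire) (a b : ℕ) :
    restrict x (a + b) = restrict x a ++ restrict (shift a x) b := by
  simp [restrict, shift, List.range_add, Function.comp_def, add_comm]

theorem concat_of_lt {s : List ℕ} {i : ℕ} (h : i < s.length) (x : Baire) : concat s x i = s[i] :=
  dif_pos h

theorem concat_length_add (s : List ℕ) (x : Baire) (i : ℕ) : concat s x (i + s.length) = x i := by
  simp [concat]

theorem restrict_concat_length (s : List ℕ) (x : Baire) : restrict (concat s x) s.length = s :=
  List.ext_getElem (by simp [restrict]) fun i _ h => by simp [restrict, concat_of_lt h]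

theorem shift_concat (s : List ℕ) (x : Baire) : shift s.length (concat s x) = x :=
  funext fun i => concat_length_add s x i

theorem restrict_concat (s : List ℕ) (x : Baire) (l : ℕ) :
    restrict (concat s x) (s.length + l) = s ++ restrict x l := by
  rw [restrict_add, restrict_concat_length, shift_concat]

theorem concat_shift {s : List ℕ} {x : Baire} (h : restrict x s.length = s) :
    concat s (shift s.length x) = x := by
  funext i
  by_cases hi : i < s.length
  · have h' := restrict_getElem? x hi
    rw [h, List.getElem?_eq_getElem hi] at h'
    rw [concat_of_lt hi, Option.some.inj h']
  · obtain ⟨j, rfl⟩ := Nat.exists_eq_add_of_le (not_lt.1 hi)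
    rw [add_comm, concat_length_add, shift]

theorem mem_concat_image {s : List ℕ} {A : Set Baire} {x : Baire} :
    x ∈ concat s '' A ↔ restrict x s.length = s ∧ shift s.length x ∈ A := by
  constructor
  · rintro ⟨y, hy, rfl⟩
    exact ⟨restrict_concat_length s y, by rwa [shift_concat]⟩
  · rintro ⟨h, hx⟩
    exact ⟨_, hx, concat_shift h⟩

theorem restrict_take (x : Baire) {a b : ℕ} (h : a ≤ b) : (restrict x b).take a = restrict x a := by
  obtain ⟨c, rfl⟩ := Nat.exists_eq_add_of_le h
  rw [restrict_add, List.take_left' (length_restrict x a)]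

theorem restrict_drop (x : Baire) (a b : ℕ) :
    (restrict x (a + b)).drop a = restrict (shift a x) b := by
  rw [restrict_add, List.drop_left' (length_restrict x a)]

theorem mem_nbhd_of_prefix {x : Baire} {s t : List ℕ} (h : s <+: t) (hx : x ∈ nbhd t) :
    x ∈ nbhd s := by
  have hx' : restrict x t.length = t := hx
  have h1 := List.prefix_iff_eq_take.1 h
  rw [← hx', restrict_take x h.length_le] at h1
  exact h1.symm

theorem concat_mem_nbhd (s : List ℕ) (x : Baire) (l : ℕ) :
    concat s x ∈ nbhd (s ++ restrict x l) := by
  rw [nbhd, Set.mem_ofPred_eq, List.length_append, length_restrict, restrict_concat]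

theorem restrict_succ_eq_cons (x : Baire) (l : ℕ) :
    restrict x (l + 1) = x 0 :: restrict (shift 1 x) l := by
  rw [add_comm, restrict_add]
  rfl

theorem restrict_zero_fun (l : ℕ) : restrict 0 l = List.replicate l 0 := by
  simp [restrict, List.eq_replicate_iff]

/-! ### Computable functions on the Baire space -/

theorem isComputable_concat (s : List ℕ) : IsComputable (concat s) := by
  refine ⟨fun t => s ++ t, (Primrec.list_append.comp (Primrec.const s) Primrec.id).to_comp,
    fun t u h => (List.prefix_append_right_inj s).2 h, fun x => ?_, fun x n => ?_⟩
  · simp only [List.length_append, length_restrict]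
    exact Filter.tendsto_atTop_mono (fun n => Nat.le_add_left n s.length) Filter.tendsto_id
  · exact concat_mem_nbhd s x n

theorem isComputable_shift (l : ℕ) : IsComputable (shift l) := by
  refine ⟨List.drop l, (Primrec.list_drop.comp (Primrec.const l) Primrec.id).to_comp,
    fun t u h => h.drop l, fun x => ?_, fun x n => ?_⟩
  · simp only [List.length_drop, length_restrict]
    exact Filter.tendsto_sub_atTop_nat l
  · rcases le_total n l with h | h
    · rw [List.drop_eq_nil_of_le (by simpa [length_restrict] using h)]
      rfl
    · obtain ⟨c, rfl⟩ := Nat.exists_eq_add_of_le h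
      rw [restrict_drop, mem_nbhd_iff_eq_restrict, length_restrict]

open Classical in
/-- The function collapsing to the zero sequence all sequences whose first term is not in a
recursive set. -/
theorem isComputable_ite_zero {X : Set ℕ} (hX : ComputablePred fun n => n ∈ X) :
    IsComputable fun x => if x 0 ∈ X then x else 0 := by
  have hc : Computable fun s : List ℕ =>
      bif decide (s.headI ∈ X) then s else s.map fun _ => 0 :=
    Computable.cond (hX.decide.comp Primrec.list_headI.to_comp) Computable.id
      (Primrec.list_map Primrec.id (Primrec.const 0).to₂).to_comp
  refine ⟨_, hc, fun s t h => ?_, fun x => ?_, fun x n => ?_⟩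
  · cases s with
    | nil => simp
    | cons a s =>
      obtain ⟨u, rfl⟩ := h
      by_cases ha : a ∈ X
      · simp [ha]
      · simpa [ha] using ⟨List.replicate u.length 0, (List.replicate_add _ _ _).symm⟩
  · have : ∀ n, (bif decide ((restrict x n).headI ∈ X) then restrict x n
        else (restrict x n).map fun _ => 0).length = n := fun n => by
      cases decide ((restrict x n).headI ∈ X) <;> simp [length_restrict]
    simp only [this]
    exact Filter.tendsto_id
  · cases n with
    | zero => simp [restrict, nbhd]
    | succ n =>
      rw [mem_nbhd_iff_eq_restrict]
      by_cases hx : x 0 ∈ X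
      · simp [restrict_succ_eq_cons x n, hx, length_restrict]
      · simp [restrict_succ_eq_cons x n, hx, length_restrict, restrict_zero_fun, List.replicate_succ]

/-- The number of stages at which `n` has not yet appeared, among the first `u`. -/
def waiting (d : ℕ → ℕ → Bool) (n u : ℕ) : ℕ :=
  Nat.rec 0 (fun i w => bif d n i then w else w + 1) u

theorem waiting_succ (d : ℕ → ℕ → Bool) (n u : ℕ) :
    waiting d n (u + 1) = bif d n u then waiting d n u else waiting d n u + 1 := rfl

theorem waiting_mono (d : ℕ → ℕ → Bool) (n : ℕ) : Monotone (waiting d n) :=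
  monotone_nat_of_le_succ fun u => by rw [waiting_succ]; cases d n u <;> simp

theorem waiting_of_false {d : ℕ → ℕ → Bool}
    (hmono : ∀ n u v, u ≤ v → d n u = true → d n v = true)
    {n u : ℕ} (h : d n u = false) : waiting d n u = u := by
  have h' : ∀ v, v ≤ u → waiting d n v = v := by
    intro v
    induction v with
    | zero => exact fun _ => rfl
    | succ v ih =>
      intro hv
      have : d n v = false := by
        by_contra hc
        simp [hmono n v u (by omega) (by simpa using hc)] at h
      rw [waiting_succ, this, ih (by omega)]
      rfl
  exact h' u le_rfl

theorem waiting_of_true {d : ℕ → ℕ → Bool}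
    (hmono : ∀ n u v, u ≤ v → d n u = true → d n v = true)
    {n u v : ℕ} (huv : u ≤ v) (h : d n u = true) :
    waiting d n v = waiting d n u := by
  induction v, huv using Nat.le_induction with
  | base => rfl
  | succ v hv ih => rw [waiting_succ, hmono n u v hv h, cond_true, ih]

theorem waiting_eq_of_true {d : ℕ → ℕ → Bool}
    (hmono : ∀ n u v, u ≤ v → d n u = true → d n v = true)
    {n u v : ℕ} (hu : d n u = true) (hv : d n v = true) :
    waiting d n u = waiting d n v := by
  rcases le_total u v with h | h
  · exact (waiting_of_true hmono h hu).symm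
  · exact waiting_of_true hmono h hv

/-- While waiting for the first term of `x` to be enumerated in a recursively enumerable set `X`,
one may output zeros, and continue with the rest of `x` once it has been. -/
theorem exists_isComputable_delay {d : ℕ → ℕ → Bool}
    (hmono : ∀ n u v, u ≤ v → d n u = true → d n v = true)
    (hd : Primrec₂ d) :
    ∃ f : Baire → Baire, IsComputable f ∧
      (∀ x, (∃ u, d (x 0) u = true) →
        ∃ k, f x = concat (x 0 :: List.replicate k 0) (shift 1 x)) ∧
      (∀ x, (¬ ∃ u, d (x 0) u = true) → f x = concat [x 0] 0) := by
  classical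
  let f : Baire → Baire := fun x => if h : ∃ u, d (x 0) u = true then
    concat (x 0 :: List.replicate (waiting d (x 0) h.choose) 0) (shift 1 x) else concat [x 0] 0
  refine ⟨f, ?_, fun x h => ⟨_, dif_pos h⟩, fun x h => dif_neg h⟩
  let φ : List ℕ → List ℕ := fun s => List.casesOn s [] fun n t =>
    (n :: List.replicate (waiting d n (t.length + 1)) 0) ++ bif d n (t.length + 1) then t else []
  have hw : Primrec₂ (waiting d) := by
    have h : Primrec₂ fun (p : ℕ × ℕ) (q : ℕ × ℕ) => bif d p.1 q.1 then q.2 else q.2 + 1 :=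
      Primrec.cond (hd.comp (Primrec.fst.comp Primrec.fst) (Primrec.fst.comp Primrec.snd))
        (Primrec.snd.comp Primrec.snd) (Primrec.succ.comp (Primrec.snd.comp Primrec.snd))
    exact Primrec.nat_rec' Primrec.snd (Primrec.const 0) h
  have hrep : Primrec fun m : ℕ => List.replicate m 0 :=
    (Primrec.list_map Primrec.list_range (Primrec.const 0).to₂).of_eq fun m => by simp
  have hφ : Primrec φ := by
    have hn : Primrec fun p : List ℕ × ℕ × List ℕ => p.2.1 := Primrec.fst.comp Primrec.snd
    have ht : Primrec fun p : List ℕ × ℕ × List ℕ => p.2.2 := Primrec.snd.comp Primrec.snd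
    have hl : Primrec fun p : List ℕ × ℕ × List ℕ => p.2.2.length + 1 :=
      Primrec.succ.comp (Primrec.list_length.comp ht)
    have h1 := Primrec.list_cons.comp hn (hrep.comp (hw.comp hn hl))
    have h2 := Primrec.cond (hd.comp hn hl) ht (Primrec.const [])
    have h3 := Primrec.list_append.comp h1 h2
    exact Primrec.list_casesOn Primrec.id (Primrec.const []) h3.to₂
  have hφ_succ : ∀ x l, φ (restrict x (l + 1)) =
      (x 0 :: List.replicate (waiting d (x 0) (l + 1)) 0) ++
        bif d (x 0) (l + 1) then restrict (shift 1 x) l else [] := by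
    intro x l
    simp only [φ, restrict_succ_eq_cons, length_restrict]
  refine ⟨φ, hφ.to_comp, fun s t hst => ?_, fun x => ?_, fun x l => ?_⟩
  · cases s with
    | nil => simp [φ]
    | cons n s =>
      obtain ⟨v, rfl⟩ := hst
      have hle : s.length + 1 ≤ (s ++ v).length + 1 := by simp
      simp only [φ, List.cons_append, List.prefix_cons_inj]
      cases h : d n (s.length + 1) with
      | false =>
        obtain ⟨c, hc⟩ := Nat.exists_eq_add_of_le (waiting_mono d n hle)
        rw [hc, List.replicate_add, cond_false, List.append_nil, List.append_assoc]
        exact List.prefix_append _ _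
      | true =>
        rw [waiting_of_true hmono hle h, hmono _ _ _ hle h]
        simp
  · refine Filter.tendsto_atTop_mono (fun l => ?_) Filter.tendsto_id
    cases l with
    | zero => simp
    | succ l =>
      rw [hφ_succ]
      cases h : d (x 0) (l + 1) with
      | false => simp [waiting_of_false hmono h]
      | true => simp [length_restrict]
  · cases l with
    | zero => rfl
    | succ l =>
      rw [hφ_succ]
      by_cases hx : ∃ u, d (x 0) u = true
      · simp only [f, dif_pos hx]
        cases h : d (x 0) (l + 1) with
        | false =>
          have hlt : l + 1 ≤ hx.choose := by
            by_contra hc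
            simp [hmono _ _ (l + 1) (by omega) hx.choose_spec] at h
          refine mem_nbhd_of_prefix ?_ (restrict_concat_length _ _)
          obtain ⟨c, hc⟩ := Nat.exists_eq_add_of_le (waiting_mono d (x 0) hlt)
          rw [hc, List.replicate_add]
          exact ⟨List.replicate c 0, by simp⟩
        | true =>
          rw [waiting_eq_of_true hmono h hx.choose_spec]
          exact concat_mem_nbhd _ _ _
      · simp only [f, dif_neg hx]
        have h : d (x 0) (l + 1) = false := by
          by_contra hc
          exact hx ⟨_, by simpa using hc⟩
        rw [h, cond_false, List.append_nil, ← restrict_zero_fun]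
        exact concat_mem_nbhd [x 0] 0 _

/-! ### Membership in the unions -/

theorem mem_psi0 {A : ℕ → Set Baire} {X : Set ℕ} {x : Baire} :
    x ∈ psi0 A X ↔ x 0 ∈ X ∧ shift 1 x ∈ A (x 0) := by
  simp only [psi0, Set.mem_iUnion, exists_prop, mem_concat_image]
  constructor
  · rintro ⟨n, hn, h, hx⟩
    obtain rfl : x 0 = n := by simpa [restrict] using h
    exact ⟨hn, hx⟩
  · rintro ⟨hn, hx⟩
    exact ⟨_, hn, by simp [restrict], hx⟩

/-- The union over all `k`, `i` of the sets `0 ⌢ ⋯ ⌢ 0 ⌢ (i + 1) ⌢ A`, with `k` zeros. -/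
def padded (A : Set Baire) : Set Baire :=
  {x | ∃ k, (∀ j < k, x j = 0) ∧ x k ≠ 0 ∧ shift (k + 1) x ∈ A}

theorem mem_padded {A : Set Baire} {x : Baire} :
    x ∈ padded A ↔ ∃ k i, x ∈ concat (List.replicate k 0 ++ [i + 1]) '' A := by
  refine exists_congr fun k => ?_
  have hr : ∀ i, restrict x (k + 1) = List.replicate k 0 ++ [i + 1] ↔
      (∀ j < k, x j = 0) ∧ x k = i + 1 := by
    intro i
    have h1 : restrict (shift k x) 1 = [x k] := by simp [restrict, shift]
    have h0 : restrict x k = List.replicate k 0 ↔ ∀ j < k, x j = 0 := by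
      rw [← restrict_zero_fun, restrict_eq_iff]
      rfl
    rw [restrict_add, h1, ← h0]
    constructor
    · intro h
      have h' := List.append_inj' h rfl
      exact ⟨h'.1, by simpa using h'.2⟩
    · rintro ⟨h, h'⟩
      rw [h, h']
  simp only [mem_concat_image, List.length_append, List.length_replicate, List.length_singleton, hr]
  constructor
  · rintro ⟨h, hne, hA⟩
    exact ⟨x k - 1, ⟨h, by omega⟩, hA⟩
  · rintro ⟨i, ⟨h, hi⟩, hA⟩
    exact ⟨h, by omega, hA⟩

theorem zero_notMem_padded (A : Set Baire) : 0 ∉ padded A := fun ⟨_, _, h, _⟩ => h rfl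

theorem concat_replicate_mem_padded {A : Set Baire} {x : Baire} (k : ℕ) :
    concat (List.replicate k 0) x ∈ padded A ↔ x ∈ padded A := by
  have hlt : ∀ j < k, concat (List.replicate k 0) x j = 0 := fun j hj => by
    rw [concat_of_lt (by simpa using hj), List.getElem_replicate]
  have hadd : ∀ j, concat (List.replicate k 0) x (j + k) = x j := fun j => by
    simpa using concat_length_add (List.replicate k 0) x j
  have hshift : ∀ l, shift (l + k + 1) (concat (List.replicate k 0) x) = shift (l + 1) x :=
    fun l => funext fun i => by rw [shift, shift, ← hadd]; congr 1; omega
  constructor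
  · rintro ⟨l, h0, hne, hA⟩
    have hkl : k ≤ l := not_lt.1 fun h => hne (hlt l h)
    obtain ⟨c, rfl⟩ := Nat.exists_eq_add_of_le' hkl
    exact ⟨c, fun j hj => by rw [← hadd, h0 _ (by omega)], by rwa [← hadd], by rwa [← hshift]⟩
  · rintro ⟨c, h0, hne, hA⟩
    refine ⟨c + k, fun j hj => ?_, by rwa [hadd], by rwa [hshift]⟩
    rcases lt_or_ge j k with h | h
    · exact hlt j h
    · obtain ⟨i, rfl⟩ := Nat.exists_eq_add_of_le' h
      rw [hadd, h0 i (by omega)]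

theorem restrict_cons_iff {x : Baire} {n : ℕ} {s : List ℕ} :
    restrict x (n :: s).length = n :: s ↔ x 0 = n ∧ restrict (shift 1 x) s.length = s := by
  rw [List.length_cons, restrict_succ_eq_cons, List.cons.injEq]

theorem mem_concat_cons_image {x : Baire} {n : ℕ} {s : List ℕ} {A : Set Baire} :
    x ∈ concat (n :: s) '' A ↔ x 0 = n ∧ shift 1 x ∈ concat s '' A := by
  rw [mem_concat_image, mem_concat_image, restrict_cons_iff, and_assoc]
  rfl

theorem mem_psi1 {A : ℕ → Set Baire} {X : Set ℕ} {x : Baire} :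
    x ∈ psi1 A X ↔ x 0 ∈ X ∧ shift 1 x ∈ padded (A (x 0)) := by
  simp only [psi1, Set.mem_iUnion, exists_prop, mem_concat_cons_image, mem_padded]
  constructor
  · rintro ⟨n, hn, k, i, rfl, h⟩
    exact ⟨hn, k, i, h⟩
  · rintro ⟨hn, k, i, h⟩
    exact ⟨_, hn, k, i, rfl, h⟩

/-! ### Complexity of the unions -/

theorem isPi01_psi0 {A : ℕ → Set Baire} (hA : IsPi01Seq A) {X : Set ℕ}
    (hX : ComputablePred fun n => n ∈ X) : IsPi01 (psi0 A X) := by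
  obtain ⟨b, hb, hXb⟩ := ComputablePred.computable_iff.1 hX
  have hXb' : ∀ n, n ∈ X ↔ b n = true := fun n => iff_of_eq (congrFun hXb n)
  obtain ⟨W, hW, hWA⟩ := isPi01Seq_iff.1 hA
  obtain ⟨d, hd, hWd, -⟩ := REPred.exists_stages hW
  let e : List ℕ → ℕ → Bool := fun s u => decide (1 ≤ s.length) &&
    (!b s.headI || d (s.headI, s.tail) u)
  have he : Computable₂ e := by
    have hs : Computable fun p : List ℕ × ℕ => p.1.headI := (Primrec.list_headI.comp .fst).to_comp
    have h1 : Computable fun p : List ℕ × ℕ => decide (1 ≤ p.1.length) :=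
      (PrimrecPred.decide (Primrec.nat_le.comp (Primrec.const 1)
        (Primrec.list_length.comp Primrec.fst))).to_comp
    have h2 : Computable fun p : List ℕ × ℕ => !b p.1.headI :=
      Primrec.not.to_comp.comp (hb.comp hs)
    have h3 : Computable fun p : List ℕ × ℕ => d (p.1.headI, p.1.tail) p.2 :=
      (hd.comp ((Primrec.list_headI.comp .fst).pair (Primrec.list_tail.comp .fst)) .snd).to_comp
    exact Primrec.and.to_comp.comp h1 (Primrec.or.to_comp.comp h2 h3)
  refine ⟨{s | ∃ u, e s u = true}, REPred.exists_nat he, Set.ext fun x => ?_⟩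
  rw [Set.mem_compl_iff, mem_psi0, not_and_or, hWA, hXb', Bool.not_eq_true]
  simp only [Set.mem_iUnion, Set.mem_ofPred_eq, exists_prop, hWd]
  constructor
  · intro h
    obtain ⟨l, u, hu⟩ : ∃ l u, b (x 0) = false ∨ d (x 0, restrict (shift 1 x) l) u = true := by
      rcases h with h | ⟨l, u, hu⟩
      · exact ⟨0, 0, Or.inl h⟩
      · exact ⟨l, u, Or.inr hu⟩
    refine ⟨restrict x (l + 1), ⟨u, ?_⟩, by simp [nbhd, length_restrict]⟩
    simpa [e, restrict_succ_eq_cons] using hu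
  · rintro ⟨s, ⟨u, hu⟩, hx⟩
    cases s with
    | nil => simp [e] at hu
    | cons n s =>
      obtain ⟨rfl, hs⟩ := restrict_cons_iff.1 hx
      simp only [e, List.length_cons, List.headI_cons, List.tail_cons, Bool.and_eq_true,
        Bool.or_eq_true, Bool.not_eq_true'] at hu
      rcases hu.2 with h | h
      · exact Or.inl h
      · exact Or.inr ⟨s.length, u, by rwa [hs]⟩

/-- Uniformly `Π⁰₁` sequences are closed under recursive reindexing, prefixing with a recursive
sequence of finite sequences, and replacing a recursive subsequence by empty sets. -/
theorem IsPi01Seq.concat_image {A : ℕ → Set Baire} (hA : IsPi01Seq A) {b : ℕ → Bool} {ν : ℕ → ℕ}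
    {σ : ℕ → List ℕ} (hb : Primrec b) (hν : Primrec ν) (hσ : Primrec σ) :
    IsPi01Seq fun q => {x | b q = true ∧ x ∈ concat (σ q) '' A (ν q)} := by
  obtain ⟨W, hW, hWA⟩ := isPi01Seq_iff.1 hA
  obtain ⟨d, hd, hWd, -⟩ := REPred.exists_stages hW
  let e : ℕ × List ℕ → ℕ → Bool := fun p u => !b p.1 || (decide ((σ p.1).length ≤ p.2.length) &&
    (!decide (p.2.take (σ p.1).length = σ p.1) || d (ν p.1, p.2.drop (σ p.1).length) u))
  have he : Primrec₂ e := by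
    have hq : Primrec fun p : (ℕ × List ℕ) × ℕ => p.1.1 := Primrec.fst.comp Primrec.fst
    have hs : Primrec fun p : (ℕ × List ℕ) × ℕ => p.1.2 := Primrec.snd.comp Primrec.fst
    have hσq := hσ.comp hq
    have hl := Primrec.list_length.comp hσq
    have h1 := Primrec.not.comp (hb.comp hq)
    have h2 := PrimrecPred.decide (Primrec.nat_le.comp hl (Primrec.list_length.comp hs))
    have h3 := Primrec.not.comp
      (PrimrecPred.decide (Primrec.eq.comp (Primrec.list_take.comp hl hs) hσq))
    have h4 := hd.comp ((hν.comp hq).pair (Primrec.list_drop.comp hl hs)) Primrec.snd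
    exact Primrec.or.comp h1 (Primrec.and.comp h2 (Primrec.or.comp h3 h4))
  refine isPi01Seq_iff.2 ⟨_, REPred.exists_nat he.to_comp, fun q x => ?_⟩
  simp only [Set.mem_ofPred_eq, not_and_or, mem_concat_image, hWA, hWd, e, length_restrict,
    Bool.and_eq_true, Bool.or_eq_true, Bool.not_eq_true', decide_eq_false_iff_not,
    decide_eq_true_eq, Bool.not_eq_true]
  constructor
  · rintro (h | h | ⟨l, u, h⟩)
    · exact ⟨0, 0, Or.inl h⟩
    · exact ⟨(σ q).length, 0, Or.inr ⟨le_rfl, Or.inl (by rwa [restrict_take x le_rfl])⟩⟩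
    · exact ⟨(σ q).length + l, u, Or.inr ⟨Nat.le_add_right _ _, Or.inr (by rwa [restrict_drop])⟩⟩
  · rintro ⟨l, u, h | ⟨hl, h⟩⟩
    · exact Or.inl h
    · rw [restrict_take x hl] at h
      obtain ⟨c, rfl⟩ := Nat.exists_eq_add_of_le hl
      rw [restrict_drop] at h
      exact Or.inr (h.imp_right fun h => ⟨c, u, h⟩)

theorem isSigma02_psi1 {A : ℕ → Set Baire} (hA : IsPi01Seq A) {X : Set ℕ}
    (hX : REPred fun n => n ∈ X) : IsSigma02 (psi1 A X) := by
  obtain ⟨d, hd, hXd, -⟩ := REPred.exists_stages hX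
  let ν : ℕ → ℕ := fun q => (Denumerable.ofNat (ℕ × ℕ × ℕ × ℕ) q).1
  let κ : ℕ → ℕ := fun q => (Denumerable.ofNat (ℕ × ℕ × ℕ × ℕ) q).2.1
  let ι : ℕ → ℕ := fun q => (Denumerable.ofNat (ℕ × ℕ × ℕ × ℕ) q).2.2.1
  let υ : ℕ → ℕ := fun q => (Denumerable.ofNat (ℕ × ℕ × ℕ × ℕ) q).2.2.2
  have h0 : Primrec (Denumerable.ofNat (ℕ × ℕ × ℕ × ℕ)) := Primrec.ofNat _
  have hν : Primrec ν := Primrec.fst.comp h0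
  have hκ : Primrec κ := Primrec.fst.comp (Primrec.snd.comp h0)
  have hι : Primrec ι := Primrec.fst.comp (Primrec.snd.comp (Primrec.snd.comp h0))
  have hυ : Primrec υ := Primrec.snd.comp (Primrec.snd.comp (Primrec.snd.comp h0))
  have hrep : Primrec fun q => List.replicate (κ q) 0 :=
    (Primrec.list_map (Primrec.list_range.comp hκ) (Primrec.const 0).to₂).of_eq fun q => by simp
  have hσ : Primrec fun q => ν q :: (List.replicate (κ q) 0 ++ [ι q + 1]) :=
    Primrec.list_cons.comp hν (Primrec.list_append.comp hrep
      (Primrec.list_cons.comp (Primrec.succ.comp hι) (Primrec.const [])))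
  refine ⟨_, IsPi01Seq.concat_image hA (hd.comp hν hυ) hν hσ, Set.ext fun x => ?_⟩
  simp only [psi1, Set.mem_iUnion, exists_prop, Set.mem_ofPred_eq, hXd]
  constructor
  · rintro ⟨n, ⟨u, hu⟩, k, i, hx⟩
    refine ⟨Encodable.encode (n, k, i, u), ?_⟩
    simp only [ν, κ, ι, υ, Denumerable.ofNat_encode]
    exact ⟨hu, hx⟩
  · rintro ⟨q, hu, hx⟩
    exact ⟨_, ⟨_, hu⟩, _, _, hx⟩

/-! ### The embeddings -/

theorem ne_zero_of_incomparable {a : ℕ → Baire}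
    (ha : ∀ n m, n ≠ m → ∀ g : Baire → Baire, IsComputable g → g (a n) ≠ a m)
    (n : ℕ) : 0 ≠ a n := by
  have hX : ComputablePred fun n => n ∈ (∅ : Set ℕ) :=
    ComputablePred.computable_iff.2 ⟨fun _ => false, Computable.const _, by simp⟩
  have h : IsComputable fun _ : Baire => (0 : Baire) := by
    simpa using isComputable_ite_zero hX
  exact ha (n + 1) n (by omega) _ h

theorem compReducible_psi0_iff {a : ℕ → Baire}
    (ha : ∀ n m, n ≠ m → ∀ g : Baire → Baire, IsComputable g → g (a n) ≠ a m)
    {X Y : Set ℕ} (hX : ComputablePred fun n => n ∈ X) :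
    CompReducible (psi0 (fun n => {a n}) X) (psi0 (fun n => {a n}) Y) ↔ X ⊆ Y := by
  classical
  constructor
  · rintro ⟨f, hf, h⟩ n hn
    have hmem : concat [n] (a n) ∈ psi0 (fun n => {a n}) X := mem_psi0.2 ⟨hn, rfl⟩
    rw [h] at hmem
    obtain ⟨hY, hs⟩ := mem_psi0.1 hmem
    by_contra hnY
    exact ha n _ (fun h => hnY (h ▸ hY)) _
      ((isComputable_shift 1).comp (hf.comp (isComputable_concat [n]))) hs
  · intro hXY
    refine ⟨_, isComputable_ite_zero hX, Set.ext fun x => ?_⟩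
    rw [Set.mem_preimage, mem_psi0]
    by_cases hx : x 0 ∈ X
    · rw [if_pos hx, mem_psi0]
      exact and_congr_left fun _ => iff_of_true hx (hXY hx)
    · rw [if_neg hx, mem_psi0]
      exact iff_of_false (fun h => hx h.1) fun h => ne_zero_of_incomparable ha _ h.2

/-- The function giving the reduction for `X ⊆ Y` inserts zeros as long as the first term has
not been enumerated in `X`; this is what the blocks of zeros in `psi1` are for. -/
theorem compReducible_psi1_iff {a : ℕ → Baire}
    (ha : ∀ n m, n ≠ m → ∀ g : Baire → Baire, IsComputable g → g (a n) ≠ a m)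
    {X Y : Set ℕ} (hX : REPred fun n => n ∈ X) :
    CompReducible (psi1 (fun n => {a n}) X) (psi1 (fun n => {a n}) Y) ↔ X ⊆ Y := by
  constructor
  · rintro ⟨f, hf, h⟩ n hn
    have hmem : concat [n, 1] (a n) ∈ psi1 (fun n => {a n}) X :=
      mem_psi1.2 ⟨hn, 0, by simp, by simp [shift, concat], rfl⟩
    rw [h] at hmem
    -- As `a n` is fixed, so is the number `k` of zeros in its image: removing `k + 2` terms is
    -- a computable function.
    obtain ⟨hY, k, -, -, hs⟩ := mem_psi1.1 hmem
    by_contra hnY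
    exact ha n _ (fun h => hnY (h ▸ hY)) _ ((isComputable_shift (k + 1)).comp
      ((isComputable_shift 1).comp (hf.comp (isComputable_concat [n, 1])))) hs
  · intro hXY
    obtain ⟨d, hd, hXd, hmono⟩ := REPred.exists_stages hX
    obtain ⟨f, hf, hin, hout⟩ := exists_isComputable_delay hmono hd
    refine ⟨f, hf, Set.ext fun x => ?_⟩
    rw [Set.mem_preimage, mem_psi1, mem_psi1]
    by_cases hx : x 0 ∈ X
    · obtain ⟨k, hk⟩ := hin x ((hXd _).1 hx)
      have h0 : f x 0 = x 0 := by rw [hk]; rfl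
      have h1 : shift 1 (f x) = concat (List.replicate k 0) (shift 1 x) := by
        rw [hk]
        funext i
        simp [shift, concat]
      rw [h0, h1, concat_replicate_mem_padded]
      exact and_congr_left fun _ => iff_of_true hx (hXY hx)
    · have h1 : shift 1 (f x) = 0 := by
        rw [hout x fun h => hx ((hXd _).2 h)]
        exact shift_concat [x 0] 0
      rw [h1]
      exact iff_of_false (fun h => hx h.1) fun h => zero_notMem_padded _ h.2

theorem deg_le_deg_iff {A B : Set Baire} : deg A ≤ deg B ↔ CompReducible A B :=
  toAntisymmetrization_le_toAntisymmetrization_iff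

end BaireComp

open BaireComp

theorem theorem3p1 :
    ∃ A : ℕ → Set BaireComp.Baire,
      BaireComp.IsPi01Seq A ∧
      (∀ n, (A n).Nonempty) ∧
      (∀ n, ¬ ∃ g : BaireComp.Baire → BaireComp.Baire,
        BaireComp.IsComputable g ∧ g '' A n ⊆ ⋃ (m : ℕ) (_ : m ≠ n), A m) ∧
      (∃ e : BaireComp.RecursiveSet ↪o BaireComp.DegIn {B | BaireComp.IsPi01 B},
        ∀ X, (e X : BaireComp.CompDeg) = BaireComp.deg (BaireComp.psi0 A X)) ∧
      (∃ e : BaireComp.RESet ↪o BaireComp.DegIn {B | BaireComp.IsSigma02 B},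
        ∀ X, (e X : BaireComp.CompDeg) = BaireComp.deg (BaireComp.psi1 A X)) := by
  have ha : ∀ n m, n ≠ m → ∀ g : Baire → Baire, IsComputable g → g (solution n) ≠ solution m :=
    fun n m hnm g hg => apply_solution_ne hnm hg
  refine ⟨fun n => {solution n}, isPi01Seq_singleton_solution,
    fun n => Set.singleton_nonempty _, ?_, ?_, ?_⟩
  · rintro n ⟨g, hg, h⟩
    obtain ⟨m, hm, hgm⟩ := Set.mem_iUnion₂.1 (h ⟨solution n, rfl, rfl⟩)
    exact ha n m hm.symm g hg hgm
  · refine ⟨OrderEmbedding.ofMapLEIff (fun X => ⟨deg (psi0 (fun n => {solution n}) X.1),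
      _, isPi01_psi0 isPi01Seq_singleton_solution X.2, rfl⟩) fun X Y => ?_, fun X => rfl⟩
    exact deg_le_deg_iff.trans (compReducible_psi0_iff ha X.2)
  · refine ⟨OrderEmbedding.ofMapLEIff (fun X => ⟨deg (psi1 (fun n => {solution n}) X.1),
      _, isSigma02_psi1 isPi01Seq_singleton_solution X.2, rfl⟩) fun X Y => ?_, fun X => rfl⟩
    exact deg_le_deg_iff.trans (compReducible_psi1_iff ha X.2)
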